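/- Let $q$ be a prime power, let $n,m,t$ be non-negative integers with $m\ge n+1$ and $t<n$, and fix an $\mathbb F_q$-linear identification of $\mathbb F_{q^m}$ with $\mathbb F_q^m$, so that a vector of $\mathbb F_{q^m}^n$ becomes an $m\times n$ matrix over $\mathbb F_q$; the rank distance of $\mathbf x,\mathbf y\in\mathbb F_{q^m}^n$ is the rank of the matrix of $\mathbf y-\mathbf x$. An $\mathbb F_{q^m}$-linear code $\mathcal C\subseteq\mathbb F_{q^m}^n$ has parameters $[n,k,d]_{q^m}$ if its dimension over $\mathbb F_{q^m}$ is $k$ and its minimum rank distance is $d$, and it is maximum rank distance (MRD) if $k+d=n+1$. Then there exist an MRD code $\mathcal C\subseteq\mathbb F_{q^m}^n$ of parameters $[n,t+1,n-t]_{q^m}$ and a vector $\mathbf h\in\mathbb F_{q^m}^n$ such that, for all $\boldsymbol\lambda^{(1)},\dots,\boldsymbol\lambda^{(t)}\in\mathbb F_q^n$ and for $\mathbf x$ uniformly random in $\mathcal C$, the value $\mathbf h\mathbf x^T$ is completely undetermined even if $\boldsymbol\lambda^{(1)}\mathbf x^T,\dots,\boldsymbol\lambda^{(t)}\mathbf x^T$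 are known: conditioned on any value that the tuple $(\boldsymbol\lambda^{(1)}\mathbf x^T,\dots,\boldsymbol\lambda^{(t)}\mathbf x^T)$ takes with positive probability, $\mathbf h\mathbf x^T$ is uniformly distributed on $\mathbb F_{q^m}$. -/

import Mathlib

/-- The `m × n` matrix over `F` of a vector `x ∈ K^n`, under an identification `φ` of the field
`K` with `F^m`: the `j`-th column is the expansion of `x j`. -/
def expansionMatrix {F K : Type*} [Field F] [Field K] [Algebra F K] {m n : ℕ}
    (φ : K ≃ₗ[F] (Fin m → F)) (x : Fin n → K) : Matrix (Fin m) (Fin n) F :=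
  Matrix.of fun i j => φ (x j) i

/-- The rank distance on `K^n`. -/
noncomputable def rankDist {F K : Type*} [Field F] [Field K] [Algebra F K] {m n : ℕ}
    (φ : K ≃ₗ[F] (Fin m → F)) (x y : Fin n → K) : ℕ :=
  (expansionMatrix φ y - expansionMatrix φ x).rank

/-- The `K`-linear rank-metric code `C` of length `n` has dimension `k` and minimum rank
distance `d`. -/
structure HasRankParameters {F K : Type*} [Field F] [Field K] [Algebra F K] {m n : ℕ}
    (φ : K ≃ₗ[F] (Fin m → F)) (C : Submodule K (Fin n → K)) (k d : ℕ) : Prop where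
  dim_eq : Module.finrank K C = k
  minDist : IsLeast {r : ℕ | ∃ x ∈ C, ∃ y ∈ C, x ≠ y ∧ rankDist φ x y = r} d

/-- Maximum rank distance codes: `k + d = n + 1`. -/
def IsMRD {F K : Type*} [Field F] [Field K] [Algebra F K] {m n : ℕ}
    (φ : K ≃ₗ[F] (Fin m → F)) (C : Submodule K (Fin n → K)) : Prop :=
  ∃ k d : ℕ, HasRankParameters φ C k d ∧ k + d = n + 1

/-- The law of a uniformly random codeword of `C`. -/
noncomputable def uniformCodeword {K : Type*} [Field K] [Finite K] {n : ℕ}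
    (C : Submodule K (Fin n → K)) : PMF C :=
  letI : Fintype C := Fintype.ofFinite C
  PMF.uniformOfFintype C

/-- For `ω` drawn from `p`, the value `secret ω` is completely undetermined when `view ω` is
known: conditioned on any value that `view ω` takes with positive probability, `secret ω` is
uniformly distributed on the whole of `β`. -/
def CompletelyUndetermined {Ω α β : Type*} [Fintype β] [Nonempty β]
    (p : PMF Ω) (secret : Ω → β) (view : Ω → α) : Prop :=
  ∀ (a : α) (ha : ∃ ω ∈ {ω | view ω = a}, ω ∈ p.support),
    (p.filter {ω | view ω = a} ha).map secret = PMF.uniformOfFintype β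

/-! The code is a Gabidulin code: its words are the evaluations, at `n` points `g j` of `K` that are
linearly independent over `F`, of the linearized polynomials `∑ i ≤ t, c i * X ^ (q ^ i)`. Such a
polynomial is an `F`-linear map, and having at most `q ^ t` roots it has a kernel of dimension at
most `t` unless it is zero; so a nonzero word has rank at least `n - t`. The secret is the value of
the polynomial at a further point `b` outside the span of the `g j`, which exists because `n < m`.

By `F`-linearity an observation `∑ j, λ j * x j` is the value of the polynomial at `∑ j, λ j • g j`,
so `t` observations only concern a subspace of dimension at most `t` that does not contain `b`. That
subspace is the kernel of some linearized polynomial of the same form, and adding `K`-multiples of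
this polynomial moves the secret through all of `K` without changing the observations. -/

open Module

section LinearizedPolynomial

open Polynomial

variable {F K : Type*} [Field F] [Fintype F] [Field K] {k : ℕ}

variable (F) in
/-- The linearized polynomial `∑ i < k, c i * X ^ (q ^ i)`, with `q = |F|`. -/
noncomputable def linearizedPolynomial (c : Fin k → K) : K[X] :=
  ∑ i, C (c i) * X ^ (Fintype.card F ^ (i : ℕ))

theorem coeff_linearizedPolynomial (c : Fin k → K) (i : Fin k) :
    (linearizedPolynomial F c).coeff (Fintype.card F ^ (i : ℕ)) = c i := by
  simp [linearizedPolynomial, coeff_X_pow,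
    (Nat.pow_right_injective (Fintype.one_lt_card (α := F))).eq_iff, Fin.val_inj]

theorem linearizedPolynomial_ne_zero {c : Fin k → K} (hc : c ≠ 0) :
    linearizedPolynomial F c ≠ 0 := by
  obtain ⟨i, hi⟩ := Function.ne_iff.mp hc
  rw [← coeff_linearizedPolynomial (F := F) c i] at hi
  exact fun h => hi (by simp [h])

theorem natDegree_linearizedPolynomial_lt (c : Fin k → K) :
    (linearizedPolynomial F c).natDegree < Fintype.card F ^ k := by
  refine Nat.lt_of_le_sub_one (pow_pos Fintype.card_pos k) ?_
  refine natDegree_sum_le_of_forall_le _ _ fun i _ => (natDegree_C_mul_X_pow_le _ _).trans ?_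
  exact Nat.le_sub_one_of_lt (Nat.pow_lt_pow_right Fintype.one_lt_card i.isLt)

variable [Algebra F K]

variable (F k) in
/-- The `F`-linear map `a ↦ ∑ i < k, c i * a ^ (q ^ i)`, with `q = |F|`. It is bundled as a
`K`-linear map in the coefficient vector `c`, so that Gabidulin codes are `K`-linear. -/
noncomputable def linearizedMap : (Fin k → K) →ₗ[K] K →ₗ[F] K :=
  Fintype.linearCombination K fun i : Fin k =>
    (FiniteField.frobeniusAlgHom F K ^ (i : ℕ)).toLinearMap

theorem linearizedMap_apply (c : Fin k → K) (a : K) :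
    linearizedMap F k c a = ∑ i, c i * a ^ (Fintype.card F ^ (i : ℕ)) := by
  simp [linearizedMap, Fintype.linearCombination_apply, AlgHom.coe_pow,
    FiniteField.coe_frobeniusAlgHom, pow_iterate]

theorem eval_linearizedPolynomial (c : Fin k → K) (a : K) :
    (linearizedPolynomial F c).eval a = linearizedMap F k c a := by
  simp [linearizedPolynomial, linearizedMap_apply, eval_finsetSum]

theorem coe_ker_linearizedMap {c : Fin k → K} (hc : c ≠ 0) :
    ((linearizedMap F k c).ker : Set K) = (linearizedPolynomial F c).rootSet K := by
  ext a
  simp [mem_rootSet, linearizedPolynomial_ne_zero hc, coe_aeval_eq_eval,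
    eval_linearizedPolynomial]

theorem finite_ker_linearizedMap {c : Fin k → K} (hc : c ≠ 0) :
    Finite (linearizedMap F k c).ker := by
  have hroots := (linearizedPolynomial F c).rootSet_finite K
  rw [← coe_ker_linearizedMap hc] at hroots
  exact hroots.to_subtype

theorem finrank_ker_linearizedMap_lt {c : Fin k → K} (hc : c ≠ 0) :
    finrank F (linearizedMap F k c).ker < k := by
  have := finite_ker_linearizedMap (F := F) hc
  refine (Nat.pow_lt_pow_iff_right (Fintype.one_lt_card (α := F))).mp ?_
  calc Fintype.card F ^ finrank F (linearizedMap F k c).ker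
      = Nat.card (linearizedMap F k c).ker := by
        rw [natCard_eq_pow_finrank (K := F), Nat.card_eq_fintype_card]
    _ = ((linearizedPolynomial F c).rootSet K).ncard :=
        congrArg Set.ncard (coe_ker_linearizedMap hc)
    _ ≤ (linearizedPolynomial F c).natDegree := ncard_rootSet_le _ _
    _ < Fintype.card F ^ k := natDegree_linearizedPolynomial_lt c

theorem linearizedMap_snoc_zero (c : Fin k → K) :
    linearizedMap F (k + 1) (Fin.snoc c 0) = linearizedMap F k c := by
  ext a
  simp [linearizedMap_apply, Fin.sum_univ_castSucc]

variable {ι : Type*}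

variable (F k) in
/-- The encoding map of a Gabidulin code: it sends the coefficient vector `c` to the values at the
evaluation points `g j` of the linearized polynomial with coefficients `c`. -/
noncomputable def gabidulinMap (g : ι → K) : (Fin k → K) →ₗ[K] ι → K :=
  LinearMap.pi fun j => LinearMap.applyₗ' K (g j) ∘ₗ linearizedMap F k

@[simp]
theorem gabidulinMap_apply (g : ι → K) (c : Fin k → K) (j : ι) :
    gabidulinMap F k g c j = linearizedMap F k c (g j) :=
  rfl

theorem span_range_le_ker_linearizedMap_iff {g : ι → K} {c : Fin k → K} :
    Submodule.span F (Set.range g) ≤ (linearizedMap F k c).ker ↔ gabidulinMap F k g c = 0 := by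
  simp [Submodule.span_le, Set.range_subset_iff, funext_iff]

theorem exists_ne_zero_gabidulinMap_eq_zero [Fintype ι] (g : ι → K) (hk : Fintype.card ι < k) :
    ∃ c ≠ 0, gabidulinMap F k g c = 0 := by
  obtain ⟨c, hc, hc0⟩ := Submodule.exists_mem_ne_zero_of_ne_bot <|
    LinearMap.ker_ne_bot_of_finrank_lt (f := gabidulinMap F k g) (by simpa using hk)
  exact ⟨c, hc0, hc⟩

theorem exists_ker_linearizedMap_eq_of_finrank_add_one (W : Submodule F K) [FiniteDimensional F W]
    (hW : finrank F W + 1 = k) : ∃ c : Fin k → K, (linearizedMap F k c).ker = W := by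
  let w : Fin (finrank F W) → K := fun j => finBasis F W j
  have hspan : Submodule.span F (Set.range w) = W := by
    rw [show w = W.subtype ∘ finBasis F W from rfl, Set.range_comp, Submodule.span_image,
      (finBasis F W).span_eq, Submodule.map_subtype_top]
  obtain ⟨c, hc0, hc⟩ := exists_ne_zero_gabidulinMap_eq_zero (F := F) (k := k) w
    (by rw [Fintype.card_fin]; omega)
  have hle : W ≤ (linearizedMap F k c).ker :=
    hspan.ge.trans (span_range_le_ker_linearizedMap_iff.mpr hc)
  have hlt : finrank F (linearizedMap F k c).ker < k := finrank_ker_linearizedMap_lt hc0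
  have := finite_ker_linearizedMap (F := F) hc0
  exact ⟨c, (Submodule.eq_of_le_of_finrank_le hle (by omega)).symm⟩

theorem exists_ker_linearizedMap_eq (W : Submodule F K) [FiniteDimensional F W]
    (hW : finrank F W < k) : ∃ c : Fin k → K, (linearizedMap F k c).ker = W := by
  induction k, hW using Nat.le_induction with
  | base => exact exists_ker_linearizedMap_eq_of_finrank_add_one W rfl
  | succ k _ ih =>
    obtain ⟨c, hc⟩ := ih
    exact ⟨Fin.snoc c 0, by rw [linearizedMap_snoc_zero, hc]⟩

theorem exists_gabidulinMap_eq_zero_and_ne_zero [Fintype ι] {a : ι → K} {b : K}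
    (hb : b ∉ Submodule.span F (Set.range a)) (hι : Fintype.card ι < k) :
    ∃ c : Fin k → K, gabidulinMap F k a c = 0 ∧ linearizedMap F k c b ≠ 0 := by
  have := FiniteDimensional.span_of_finite F (Set.finite_range a)
  obtain ⟨c, hc⟩ := exists_ker_linearizedMap_eq (Submodule.span F (Set.range a))
    ((finrank_range_le_card a).trans_lt hι)
  exact ⟨c, span_range_le_ker_linearizedMap_iff.mp hc.ge, fun hcb => hb (hc.le hcb)⟩

theorem gabidulinMap_injective [Fintype ι] {g : ι → K} (hg : LinearIndependent F g)
    (hk : k ≤ Fintype.card ι) : Function.Injective (gabidulinMap F k g) := by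
  refine (injective_iff_map_eq_zero _).mpr fun c hc => ?_
  by_contra hc0
  have := finite_ker_linearizedMap (F := F) hc0
  have hle := Submodule.finrank_mono (span_range_le_ker_linearizedMap_iff (F := F).mpr hc)
  rw [finrank_span_eq_card hg] at hle
  exact (finrank_ker_linearizedMap_lt hc0).not_ge (hk.trans hle)

theorem span_range_gabidulinMap (g : ι → K) (c : Fin k → K) :
    Submodule.span F (Set.range (gabidulinMap F k g c)) =
      (Submodule.span F (Set.range g)).map (linearizedMap F k c) := by
  rw [Submodule.map_span, ← Set.range_comp]
  rfl

theorem sum_smul_gabidulinMap [Fintype ι] (g : ι → K) (c : Fin k → K) (l : ι → F) :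
    ∑ j, l j • gabidulinMap F k g c j = linearizedMap F k c (∑ j, l j • g j) := by
  simp

variable (F k) in
/-- The Gabidulin code of dimension `k` with evaluation points `g`. -/
noncomputable def gabidulinCode (g : ι → K) : Submodule K (ι → K) :=
  (gabidulinMap F k g).range

theorem finrank_gabidulinCode [Fintype ι] {g : ι → K} (hg : LinearIndependent F g)
    (hk : k ≤ Fintype.card ι) : finrank K (gabidulinCode F k g) = k := by
  rw [gabidulinCode, LinearMap.finrank_range_of_inj (gabidulinMap_injective hg hk),
    finrank_fin_fun]

end LinearizedPolynomial

section Rank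

theorem finrank_map_add_finrank_inf_ker {F V W : Type*} [DivisionRing F] [AddCommGroup V]
    [Module F V] [AddCommGroup W] [Module F W] (f : V →ₗ[F] W) (S : Submodule F V)
    [FiniteDimensional F S] :
    finrank F (S.map f) + finrank F (S ⊓ f.ker : Submodule F V) = finrank F S := by
  rw [← LinearMap.finrank_range_add_finrank_ker (f.domRestrict S), LinearMap.range_domRestrict,
    LinearMap.ker_domRestrict, ← Submodule.finrank_map_subtype_eq, Submodule.map_comap_subtype]

variable {F K : Type*} [Field F] [Field K] [Algebra F K] {m n k : ℕ}

theorem rankDist_eq_rank_sub (φ : K ≃ₗ[F] (Fin m → F)) (x y : Fin n → K) :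
    rankDist φ x y = (expansionMatrix φ (y - x)).rank := by
  rw [rankDist]
  congr 1
  ext i j
  simp [expansionMatrix]

theorem setOf_rankDist_eq_setOf_rank (φ : K ≃ₗ[F] (Fin m → F)) (C : Submodule K (Fin n → K)) :
    {r | ∃ x ∈ C, ∃ y ∈ C, x ≠ y ∧ rankDist φ x y = r} =
      {r | ∃ x ∈ C, x ≠ 0 ∧ (expansionMatrix φ x).rank = r} := by
  ext r
  constructor
  · rintro ⟨x, hx, y, hy, hxy, rfl⟩
    exact ⟨y - x, C.sub_mem hy hx, sub_ne_zero.mpr hxy.symm, (rankDist_eq_rank_sub φ x y).symm⟩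
  · rintro ⟨x, hx, hx0, rfl⟩
    exact ⟨0, C.zero_mem, x, hx, hx0.symm, by rw [rankDist_eq_rank_sub, sub_zero]⟩

theorem rank_expansionMatrix (φ : K ≃ₗ[F] (Fin m → F)) (x : Fin n → K) :
    (expansionMatrix φ x).rank = finrank F (Submodule.span F (Set.range x)) := by
  have hcol : (expansionMatrix φ x).col = φ ∘ x := rfl
  rw [Matrix.rank_eq_finrank_span_cols, hcol, Set.range_comp, ← LinearEquiv.coe_coe,
    Submodule.span_image]
  exact φ.finrank_map_eq _

variable [Fintype F] (φ : K ≃ₗ[F] (Fin m → F)) {g : Fin n → K}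

theorem rank_gabidulinMap_add_finrank_inf_ker (hg : LinearIndependent F g) (c : Fin k → K) :
    (expansionMatrix φ (gabidulinMap F k g c)).rank +
      finrank F (Submodule.span F (Set.range g) ⊓ (linearizedMap F k c).ker : Submodule F K)
        = n := by
  have := FiniteDimensional.span_of_finite F (Set.finite_range g)
  rw [rank_expansionMatrix, span_range_gabidulinMap, finrank_map_add_finrank_inf_ker,
    finrank_span_eq_card hg, Fintype.card_fin]

theorem lt_rank_gabidulinMap_add (hg : LinearIndependent F g) {c : Fin k → K} (hc : c ≠ 0) :
    n < (expansionMatrix φ (gabidulinMap F k g c)).rank + k := by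
  have := finite_ker_linearizedMap (F := F) hc
  have hinf := Submodule.finrank_mono
    (inf_le_right : Submodule.span F (Set.range g) ⊓ (linearizedMap F k c).ker ≤ _)
  have hker := finrank_ker_linearizedMap_lt (F := F) hc
  have hrank := rank_gabidulinMap_add_finrank_inf_ker φ hg c
  omega

theorem exists_rank_gabidulinMap_eq (hg : LinearIndependent F g) (hk : 0 < k) (hkn : k ≤ n) :
    ∃ c : Fin k → K, (expansionMatrix φ (gabidulinMap F k g c)).rank = n + 1 - k := by
  let e : Fin (k - 1) → Fin n := Fin.castLE (by omega)
  have hfinrank : finrank F (Submodule.span F (Set.range (g ∘ e))) = k - 1 := by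
    rw [finrank_span_eq_card (hg.comp e (Fin.castLE_injective _)), Fintype.card_fin]
  have := FiniteDimensional.span_of_finite F (Set.finite_range (g ∘ e))
  obtain ⟨c, hc⟩ := exists_ker_linearizedMap_eq (Submodule.span F (Set.range (g ∘ e)))
    (k := k) (by omega)
  have hrank := rank_gabidulinMap_add_finrank_inf_ker φ hg c
  rw [hc, inf_eq_right.mpr (Submodule.span_mono (Set.range_comp_subset_range e g)),
    hfinrank] at hrank
  exact ⟨c, by omega⟩

theorem hasRankParameters_gabidulinCode (hg : LinearIndependent F g) (hk : 0 < k) (hkn : k ≤ n) :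
    HasRankParameters φ (gabidulinCode F k g) k (n + 1 - k) := by
  refine ⟨finrank_gabidulinCode hg (by simpa using hkn), ?_⟩
  rw [setOf_rankDist_eq_setOf_rank]
  constructor
  · obtain ⟨c, hc⟩ := exists_rank_gabidulinMap_eq φ hg hk hkn
    refine ⟨gabidulinMap F k g c, ⟨c, rfl⟩, fun h0 => ?_, hc⟩
    have hrank : (expansionMatrix φ (gabidulinMap F k g c)).rank = 0 := by
      rw [rank_expansionMatrix, h0, Submodule.span_eq_bot.mpr (by simp), finrank_bot]
    omega
  · rintro _ ⟨_, ⟨c, rfl⟩, hc0, rfl⟩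
    have hlt := lt_rank_gabidulinMap_add φ hg (c := c) (by rintro rfl; simp at hc0)
    omega

end Rank

section Secrecy

open Matrix

theorem eq_uniformOfFintype_of_forall_apply_eq {β : Type*} [Fintype β] [Nonempty β] {p : PMF β}
    (hp : ∀ a b, p a = p b) : p = PMF.uniformOfFintype β := by
  ext a
  rw [PMF.uniformOfFintype_apply]
  refine ENNReal.eq_inv_of_mul_eq_one_left ?_
  calc p a * Fintype.card β = ∑ b, p b := by simp [← hp a, mul_comm]
    _ = 1 := by rw [← tsum_fintype (L := .unconditional β), p.tsum_coe]

theorem completelyUndetermined_uniformOfFintype {G A B : Type*} [AddGroup G] [Fintype G]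
    [AddGroup A] [Fintype A] [AddZeroClass B] (secret : G →+ A) (view : G →+ B)
    (h : ∀ a, ∃ x ∈ view.ker, secret x = a) :
    CompletelyUndetermined (PMF.uniformOfFintype G) secret view := by
  classical
  refine fun b hb => eq_uniformOfFintype_of_forall_apply_eq fun u v => ?_
  -- Translation by `x` preserves the view and carries the secret `u` to the secret `v`.
  obtain ⟨x, hx, hsecret⟩ := h (-u + v)
  rw [PMF.map_apply, PMF.map_apply,
    ← (Equiv.addRight x).tsum_eq fun y => if v = secret y then _ else 0]
  refine tsum_congr fun y => ?_
  have hfibre : v = secret (y + x) ↔ u = secret y := by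
    rw [map_add, hsecret, ← add_assoc, eq_comm, add_eq_right, add_neg_eq_zero, eq_comm]
  simp only [Equiv.coe_addRight, hfibre]
  simp [PMF.filter_apply, Set.indicator_apply, AddMonoidHom.mem_ker.mp hx]

theorem exists_dotProduct_eq_of_injective {K V ι : Type*} [Field K] [AddCommGroup V] [Module K V]
    [Fintype ι] {f : V →ₗ[K] ι → K} (hf : Function.Injective f) (l : V →ₗ[K] K) :
    ∃ h : ι → K, ∀ v, h ⬝ᵥ f v = l v := by
  classical
  obtain ⟨l', rfl⟩ := LinearMap.dualMap_surjective_of_injective hf l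
  exact ⟨(dotProductEquiv K ι).symm l', fun v =>
    LinearMap.congr_fun ((dotProductEquiv K ι).apply_symm_apply l') (f v)⟩

variable {F K : Type*} [Field F] [Fintype F] [Field K] [Algebra F K] {n k : ℕ}

theorem map_mulVec_gabidulinMap {ι κ : Type*} [Fintype κ] (M : Matrix ι κ F) (g : κ → K)
    (c : Fin k → K) :
    M.map (algebraMap F K) *ᵥ gabidulinMap F k g c =
      gabidulinMap F k (fun i => ∑ j, M i j • g j) c := by
  ext i
  rw [gabidulinMap_apply, ← sum_smul_gabidulinMap]
  simp [mulVec, dotProduct, Algebra.smul_def]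

theorem completelyUndetermined_gabidulinCode [Fintype K] {ι : Type*} [Fintype ι] {g h : Fin n → K}
    {b : K} (hb : b ∉ Submodule.span F (Set.range g))
    (hh : ∀ c, h ⬝ᵥ gabidulinMap F k g c = linearizedMap F k c b)
    (M : Matrix ι (Fin n) F) (hι : Fintype.card ι < k) :
    CompletelyUndetermined (uniformCodeword (gabidulinCode F k g))
      (fun x => h ⬝ᵥ (x : Fin n → K))
      (fun x => M.map (algebraMap F K) *ᵥ (x : Fin n → K)) := by
  let a : ι → K := fun i => ∑ j, M i j • g j
  have ha : Submodule.span F (Set.range a) ≤ Submodule.span F (Set.range g) :=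
    Submodule.span_le.mpr <| Set.range_subset_iff.mpr fun i =>
      Submodule.sum_smul_mem _ _ fun j _ => Submodule.subset_span ⟨j, rfl⟩
  obtain ⟨c, hca, hcb⟩ := exists_gabidulinMap_eq_zero_and_ne_zero (fun hba => hb (ha hba)) hι
  let C := gabidulinCode F k g
  let : Fintype C := Fintype.ofFinite C
  refine completelyUndetermined_uniformOfFintype
    (dotProductEquiv K (Fin n) h ∘ₗ C.subtype).toAddMonoidHom
    ((M.map (algebraMap F K)).mulVecLin ∘ₗ C.subtype).toAddMonoidHom fun u => ?_
  let r := u / linearizedMap F k c b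
  refine ⟨r • ⟨gabidulinMap F k g c, c, rfl⟩, ?_, ?_⟩
  · change M.map (algebraMap F K) *ᵥ r • gabidulinMap F k g c = 0
    rw [mulVec_smul, map_mulVec_gabidulinMap, hca, smul_zero]
  · change h ⬝ᵥ r • gabidulinMap F k g c = u
    rw [dotProduct_smul, hh, smul_eq_mul, div_mul_cancel₀ u hcb]

end Secrecy

theorem mainTheorem8 {F K : Type*} [Field F] [Fintype F] [Field K] [Fintype K] [Algebra F K]
    (q m n t : ℕ) (hF : Fintype.card F = q) (hK : Fintype.card K = q ^ m)
    (φ : K ≃ₗ[F] (Fin m → F)) (hmn : n + 1 ≤ m) (htn : t < n) :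
    ∃ (C : Submodule K (Fin n → K)) (h : Fin n → K),
      IsMRD φ C ∧ HasRankParameters φ C (t + 1) (n - t) ∧
      ∀ lam : Fin t → Fin n → F,
        CompletelyUndetermined (uniformCodeword C)
          (fun x => ∑ j, h j * (x : Fin n → K) j)
          (fun x => fun i : Fin t => ∑ j, algebraMap F K (lam i j) * (x : Fin n → K) j) := by
  have hdim : finrank F K = m := by rw [φ.finrank_eq, finrank_fin_fun]
  obtain ⟨g, hg⟩ : ∃ g : Fin n → K, LinearIndependent F g :=
    exists_linearIndependent_of_le_finrank (by omega)
  obtain ⟨b, hgb⟩ := exists_linearIndependent_snoc_of_lt_finrank hg (by omega)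
  have hb : b ∉ Submodule.span F (Set.range g) := (linearIndependent_finSnoc.mp hgb).2
  obtain ⟨h, hh⟩ := exists_dotProduct_eq_of_injective
    (gabidulinMap_injective (k := t + 1) hg (by simpa using htn))
    (LinearMap.applyₗ' K b ∘ₗ linearizedMap F (t + 1))
  have hpar : HasRankParameters φ (gabidulinCode F (t + 1) g) (t + 1) (n - t) := by
    simpa using hasRankParameters_gabidulinCode φ hg t.succ_pos htn
  exact ⟨gabidulinCode F (t + 1) g, h, ⟨t + 1, n - t, hpar, by omega⟩, hpar, fun lam =>
    completelyUndetermined_gabidulinCode hb hh lam (by simp)⟩
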